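/- Rings are associative and unital, not necessarily commutative. A topological ring is two-sided linear if its open two-sided ideals form a base of neighbourhoods of zero. Let $R$ and $S$ be complete, separated two-sided linear topological rings with countable bases of neighbourhoods of zero, and let $f\colon R\to S$ be a continuous ring homomorphism. Assume that $f$ is strongly right taut: the open two-sided ideals $I\subset R$ for which the closure of the right ideal $f(I)S\subset S$ is an open two-sided ideal of $S$ form a base of neighbourhoods of zero in $R$. For a set $X$, let $R[[X]]$ be the set of formal linear combinations $\sum_{x\in X}a_x x$ whose coefficients $a_x\in R$ converge to zero (every neighbourhood of zero contains all but finitely many $a_x$). With the unit $x\mapsto 1\cdot x$ and the multiplication $\sum_c r_c\bigl(\sum_x c_x x\bigr)\mapsto\sum_x\bigl(\sum_c r_c c_x\bigr)x$ this is a monad on the category of sets; a left $R$-contramodule is an algebra $\pi\colon R[[P]]\to P$ over it, and morphisms are morphisms of algebras. For an open right ideal $I\subset R$ let $I\curlywedge P\subset P$ be the set of all $\pi\bigl(\sum_p a_p p\bigr)$ with all $a_p\in I$; $P$ is separated if $\bigcap_I (I\curlywedge P)=0$, where $I$ runs over all open right ideals. Let $R\textrm{-Sep}$ be the full subcategory of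 separated left $R$-contramodules; define $S\textrm{-Sep}$ in the same way. Applying $f$ to coefficients gives a morphism of monads $R[[-]]\to S[[-]]$, and hence a restriction-of-scalars functor $f_\sharp\colon S\textrm{-Sep}\to R\textrm{-Sep}$. Then the following two conditions are equivalent: (1) the functor $f_\sharp\colon S\textrm{-Sep}\to R\textrm{-Sep}$ is fully faithful; (2) $f$ is a topological ring proepimorphism, that is, for every pair of open two-sided ideals $I\subset R$ and $J\subset S$ with $f(I)\subset J$, the induced homomorphism of quotient rings $R/I\to S/J$ is an epimorphism in the category of rings. -/

import Mathlib

open CategoryTheory Filter Topology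

universe u

namespace Contramodules

/-! ### Zero-convergent families and the functor `X ↦ R[[X]]` -/

/-- The set `R[[X]]` of formal linear combinations `∑ a_x x` whose family of coefficients converges
to zero in `R`: every neighbourhood of zero contains all but finitely many of the `a_x`. -/
@[ext]
structure ZeroFam (R : Type u) [Ring R] [TopologicalSpace R] (X : Type u) : Type u where
  /-- The family of coefficients. -/
  coeff : X → R
  tendsto_zero : Tendsto coeff cofinite (𝓝 0)

section Basic

variable {R : Type u} [Ring R] [TopologicalSpace R]

instance (X : Type u) : CoeFun (ZeroFam R X) (fun _ => X → R) := ⟨ZeroFam.coeff⟩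

theorem ZeroFam.ext' {X : Type u} {a b : ZeroFam R X} (h : ∀ x, a x = b x) : a = b :=
  ZeroFam.ext (funext h)

/-- The formal linear combination all of whose coefficients are zero. -/
def ZeroFam.zero (X : Type u) : ZeroFam R X := ⟨fun _ => 0, tendsto_const_nhds⟩

open Classical in
/-- The map `ε : X → R[[X]]` sending `x` to the formal linear combination `1 · x`. -/
noncomputable def ZeroFam.single {X : Type u} (x : X) : ZeroFam R X :=
  ⟨fun y => if y = x then 1 else 0, by
    refine tendsto_nhds_of_eventually_eq ?_
    have : {y : X | ¬ ((if y = x then (1 : R) else 0) = 0)} ⊆ {x} := by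
      intro y hy
      by_contra h
      exact hy (if_neg h)
    exact (Set.finite_singleton x).subset this⟩

end Basic

section Complete

variable {R : Type u} [Ring R] [UniformSpace R] [IsUniformAddGroup R] [IsTopologicalRing R]
  [CompleteSpace R] [T2Space R] [IsLinearTopology Rᵐᵒᵖ R]

theorem tendsto_zero_iff {ι : Type*} {a : ι → R} :
    Tendsto a cofinite (𝓝 0) ↔
      ∀ I : Submodule Rᵐᵒᵖ R, IsOpen (I : Set R) → {i | a i ∉ I}.Finite :=
  (IsLinearTopology.hasBasis_open_submodule Rᵐᵒᵖ).tendsto_right_iff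

theorem mul_mem_right {I : Submodule Rᵐᵒᵖ R} {r : R} (hr : r ∈ I) (s : R) : r * s ∈ I := by
  simpa using I.smul_mem (MulOpposite.op s) hr

theorem summable_of_tendsto {ι : Type*} {a : ι → R} (h : Tendsto a cofinite (𝓝 0)) :
    Summable a := by
  have : NonarchimedeanAddGroup R :=
    { is_nonarchimedean := fun U hU => by
        obtain ⟨I, hI, hIU⟩ := (IsLinearTopology.hasBasis_open_submodule Rᵐᵒᵖ).mem_iff.1 hU
        exact ⟨⟨I.toAddSubgroup, hI⟩, hIU⟩ }
  exact NonarchimedeanAddGroup.summable_of_tendsto_cofinite_zero h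

theorem tsum_mem {ι : Type*} {a : ι → R} {I : Submodule Rᵐᵒᵖ R} (hI : IsOpen (I : Set R))
    (h : ∀ i, a i ∈ I) : ∑' i, a i ∈ I := by
  by_cases ha : Summable a
  · have hc : IsClosed (I : Set R) := AddSubgroup.isClosed_of_isOpen I.toAddSubgroup hI
    exact hc.mem_of_tendsto ha.hasSum (Eventually.of_forall fun s => I.sum_mem fun i _ => h i)
  · rw [tsum_eq_zero_of_not_summable ha]
    exact I.zero_mem

theorem tendsto_mul_right {ι : Type*} {a : ι → R} (h : Tendsto a cofinite (𝓝 0)) (b : ι → R) :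
    Tendsto (fun i => a i * b i) cofinite (𝓝 0) := by
  rw [tendsto_zero_iff] at h ⊢
  intro I hI
  exact (h I hI).subset fun i hi hia => hi (mul_mem_right hia _)

theorem tendsto_comp_val {ι : Type*} {a : ι → R} (h : Tendsto a cofinite (𝓝 0)) (p : ι → Prop) :
    Tendsto (fun i : {i // p i} => a i) cofinite (𝓝 0) :=
  h.comp Subtype.val_injective.tendsto_cofinite

/-- If `a` is zero-convergent and every `g i` is zero-convergent, then so is the family of all
products `a i * g i j`. -/
theorem tendsto_mul_prod {ι κ : Type*} {a : ι → R} {g : ι → κ → R}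
    (ha : Tendsto a cofinite (𝓝 0)) (hg : ∀ i, Tendsto (g i) cofinite (𝓝 0)) :
    Tendsto (fun p : ι × κ => a p.1 * g p.1 p.2) cofinite (𝓝 0) := by
  rw [tendsto_zero_iff]
  intro I hI
  have h1 := tendsto_zero_iff.1 ha I hI
  have h2 : ∀ i, {j | a i * g i j ∉ I}.Finite := fun i => by
    have : Tendsto (fun j => a i * g i j) cofinite (𝓝 0) := by
      simpa using (hg i).const_mul (a i)
    exact tendsto_zero_iff.1 this I hI
  refine (h1.biUnion fun i _ => (h2 i).image (Prod.mk i)).subset ?_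
  rintro ⟨i, j⟩ hij
  simp only [Set.mem_iUnion]
  exact ⟨i, fun hi => hij (mul_mem_right hi _), j, hij, rfl⟩

theorem tendsto_tsum_mul {ι κ : Type*} {a : ι → R} {g : ι → κ → R}
    (ha : Tendsto a cofinite (𝓝 0)) (hg : ∀ i, Tendsto (g i) cofinite (𝓝 0)) :
    Tendsto (fun j => ∑' i, a i * g i j) cofinite (𝓝 0) := by
  rw [tendsto_zero_iff]
  intro I hI
  refine ((tendsto_zero_iff.1 (tendsto_mul_prod ha hg) I hI).image Prod.snd).subset ?_
  intro j hj
  by_contra hc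
  refine hj (tsum_mem hI fun i => ?_)
  by_contra hij
  exact hc ⟨(i, j), hij, rfl⟩

theorem tendsto_tsum_fiber {X Y : Type*} (f : X → Y) {a : X → R} (ha : Tendsto a cofinite (𝓝 0)) :
    Tendsto (fun y => ∑' x : {x // f x = y}, a x) cofinite (𝓝 0) := by
  rw [tendsto_zero_iff]
  intro I hI
  refine ((tendsto_zero_iff.1 ha I hI).image f).subset ?_
  intro y hy
  by_contra hc
  refine hy (tsum_mem hI fun x => ?_)
  by_contra hx
  exact hc ⟨x, hx, x.2⟩

/-- The map `R[[f]] : R[[X]] → R[[Y]]` induced by `f : X → Y`: the coefficient at `y` is the sum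
of the `a_x` over all `x` with `f x = y`. -/
noncomputable def ZeroFam.map {X Y : Type u} (f : X → Y) (a : ZeroFam R X) : ZeroFam R Y :=
  ⟨fun y => ∑' x : {x // f x = y}, a x, tendsto_tsum_fiber f a.2⟩

/-- The "opening of parentheses" `φ : R[[R[[X]]]] → R[[X]]`: the coefficient of
`∑_c r_c (∑_x c_x x)` at `x` is `∑_c r_c c_x`. -/
noncomputable def ZeroFam.join {X : Type u} (r : ZeroFam R (ZeroFam R X)) : ZeroFam R X :=
  ⟨fun x => ∑' c : ZeroFam R X, r c * c x, tendsto_tsum_mul r.2 fun c => c.2⟩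

theorem tsum_fiber {X Y : Type*} (f : X → Y) {a : X → R} (ha : Tendsto a cofinite (𝓝 0)) :
    ∑' y, ∑' x : {x // f x = y}, a x = ∑' x, a x := by
  have hs := summable_of_tendsto ha
  have hs' : Summable (fun p : (Σ y, {x // f x = y}) => a p.2) :=
    (Equiv.sigmaFiberEquiv f).summable_iff.2 hs
  rw [← (Equiv.sigmaFiberEquiv f).tsum_eq a]
  exact hs'.tsum_sigma.symm

theorem tsum_map_mul {X Y : Type u} (f : X → Y) (a : ZeroFam R X) (h : Y → R) :
    ∑' y, ZeroFam.map f a y * h y = ∑' x, a x * h (f x) := by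
  rw [← tsum_fiber f (tendsto_mul_right a.2 fun x => h (f x))]
  refine tsum_congr fun y => ?_
  change (∑' x : {x // f x = y}, a x) * h y = _
  rw [← (summable_of_tendsto (tendsto_comp_val a.2 _)).tsum_mul_right]
  exact tsum_congr fun x => by rw [x.2]

theorem map_id {X : Type u} (a : ZeroFam R X) : ZeroFam.map id a = a :=
  ZeroFam.ext' fun y => tsum_eq_single (⟨y, rfl⟩ : {x // id x = y})
    (fun x hx => (hx (Subtype.ext x.2)).elim)

theorem map_comp {X Y Z : Type u} (f : X → Y) (g : Y → Z) (a : ZeroFam R X) :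
    ZeroFam.map g (ZeroFam.map f a) = ZeroFam.map (g ∘ f) a := by
  refine ZeroFam.ext' fun z => ?_
  change ∑' y : {y // g y = z}, ∑' x : {x // f x = y}, a x = ∑' x : {x // g (f x) = z}, a x
  rw [← tsum_fiber (fun x : {x // g (f x) = z} => (⟨f x, x.2⟩ : {y // g y = z}))
    (tendsto_comp_val a.2 _)]
  refine tsum_congr fun y => ?_
  let e : {x : {x // g (f x) = z} // (⟨f x, x.2⟩ : {y // g y = z}) = y} ≃ {x // f x = y} :=
    { toFun := fun x => ⟨x.1.1, congrArg Subtype.val x.2⟩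
      invFun := fun x => ⟨⟨x.1, by rw [x.2]; exact y.2⟩, Subtype.ext x.2⟩
      left_inv := fun _ => rfl
      right_inv := fun _ => rfl }
  exact (e.tsum_eq (fun x : {x // f x = y} => a x)).symm

theorem tsum_single_mul {X : Type u} (x : X) (h : X → R) :
    ∑' y, (ZeroFam.single x : ZeroFam R X) y * h y = h x := by
  rw [tsum_eq_single x]
  · simp [ZeroFam.single]
  · intro y hy
    simp [ZeroFam.single, hy]

theorem tsum_mul_single {X : Type u} (a : ZeroFam R X) (x : X) :
    ∑' y, a y * (ZeroFam.single y : ZeroFam R X) x = a x := by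
  rw [tsum_eq_single x]
  · simp [ZeroFam.single]
  · intro y hy
    simp [ZeroFam.single, hy.symm]

theorem map_single {X Y : Type u} (f : X → Y) (x : X) :
    ZeroFam.map f (ZeroFam.single x : ZeroFam R X) = ZeroFam.single (f x) := by
  refine ZeroFam.ext' fun y => ?_
  rw [← tsum_mul_single (ZeroFam.map f _) y, tsum_map_mul, tsum_single_mul]

theorem join_single {X : Type u} (a : ZeroFam R X) :
    ZeroFam.join (ZeroFam.single a) = a :=
  ZeroFam.ext' fun x => tsum_single_mul a fun c : ZeroFam R X => c x

theorem join_map_single {X : Type u} (a : ZeroFam R X) :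
    ZeroFam.join (ZeroFam.map ZeroFam.single a) = a := by
  refine ZeroFam.ext' fun x => ?_
  change ∑' c, ZeroFam.map ZeroFam.single a c * c x = a x
  rw [tsum_map_mul _ a fun c : ZeroFam R X => c x, tsum_mul_single]

theorem tsum_join_mul {X : Type u} (r : ZeroFam R (ZeroFam R X)) (h : X → R) :
    ∑' x, ZeroFam.join r x * h x = ∑' c, r c * ∑' x, c x * h x := by
  have hp : Tendsto (fun p : ZeroFam R X × X => r p.1 * (p.1 p.2 * h p.2)) cofinite (𝓝 0) :=
    tendsto_mul_prod (g := fun (c : ZeroFam R X) x => c x * h x) r.2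
      fun c => tendsto_mul_right c.2 h
  calc ∑' x, ZeroFam.join r x * h x = ∑' x, ∑' c : ZeroFam R X, r c * (c x * h x) := by
        refine tsum_congr fun x => ?_
        change (∑' c : ZeroFam R X, r c * c x) * h x = _
        rw [← (summable_of_tendsto (tendsto_mul_right r.2 _)).tsum_mul_right]
        exact tsum_congr fun c => mul_assoc _ _ _
    _ = ∑' c : ZeroFam R X, ∑' x, r c * (c x * h x) :=
        (summable_of_tendsto hp).tsum_comm (f := fun (c : ZeroFam R X) x => r c * (c x * h x))
    _ = ∑' c : ZeroFam R X, r c * ∑' x, c x * h x := tsum_congr fun c =>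
        (summable_of_tendsto (tendsto_mul_right c.2 h)).tsum_mul_left (r c)

theorem join_join {X : Type u} (r : ZeroFam R (ZeroFam R (ZeroFam R X))) :
    ZeroFam.join (ZeroFam.map ZeroFam.join r) = ZeroFam.join (ZeroFam.join r) := by
  refine ZeroFam.ext' fun x => ?_
  change ∑' c, ZeroFam.map ZeroFam.join r c * c x = ∑' c, ZeroFam.join r c * c x
  rw [tsum_map_mul _ r fun c : ZeroFam R X => c x, tsum_join_mul r fun c : ZeroFam R X => c x]
  rfl

theorem join_map_map {X Y : Type u} (f : X → Y) (r : ZeroFam R (ZeroFam R X)) :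
    ZeroFam.join (ZeroFam.map (ZeroFam.map f) r) = ZeroFam.map f (ZeroFam.join r) := by
  refine ZeroFam.ext' fun y => ?_
  rw [← tsum_mul_single (ZeroFam.map f _) y, tsum_map_mul, tsum_join_mul]
  change ∑' c, ZeroFam.map (ZeroFam.map f) r c * c y = _
  rw [tsum_map_mul _ r fun c : ZeroFam R Y => c y]
  refine tsum_congr fun c => ?_
  rw [← tsum_map_mul f c fun z => (ZeroFam.single z : ZeroFam R Y) y, tsum_mul_single]

end Complete

/-! ### Contramodules -/

theorem hom_ext {X Y : Type u} {f g : X ⟶ Y} (h : ∀ x, f x = g x) : f = g := by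
  ext x
  exact h x

section Monad

variable (R : Type u) [Ring R] [UniformSpace R] [IsUniformAddGroup R] [IsTopologicalRing R]
  [CompleteSpace R] [T2Space R] [IsLinearTopology Rᵐᵒᵖ R]

/-- The monad `X ↦ R[[X]]` on the category of sets, for a complete, separated right linear
topological ring `R`. -/
noncomputable def contraMonad : Monad (Type u) where
  obj X := ZeroFam R X
  map f := ↾(ZeroFam.map f)
  map_id X := hom_ext fun a => map_id a
  map_comp f g := hom_ext fun a => (map_comp f g a).symm
  η := { app := fun X => ↾(ZeroFam.single)
         naturality := fun X Y f => hom_ext fun x => (map_single f x).symm }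
  μ := { app := fun X => ↾(ZeroFam.join)
         naturality := fun X Y f => hom_ext fun r => join_map_map f r }
  assoc X := hom_ext fun r => join_join r
  left_unit X := hom_ext fun a => join_single a
  right_unit X := hom_ext fun a => join_map_single a

/-- The category of left `R`-contramodules: modules over the monad `X ↦ R[[X]]`. -/
abbrev Contra : Type (u + 1) := (contraMonad R).Algebra

variable {R}

/-- The contraaction map `π : R[[P]] → P` of a left contramodule `P`. -/
def contraaction (P : Contra R) (a : ZeroFam R P.A) : P.A :=
  (ConcreteCategory.hom P.a) a

/-- The zero element of (the underlying module of) a left contramodule. -/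
def contraZero (P : Contra R) : P.A := contraaction P (ZeroFam.zero P.A)

/-- For an open right ideal `I` of `R`, the subset of `P` which is the image of `I[[P]]` under
the contraaction map. -/
def contraMul (I : Submodule Rᵐᵒᵖ R) (P : Contra R) : Set P.A :=
  {p | ∃ a : ZeroFam R P.A, (∀ x, a x ∈ I) ∧ contraaction P a = p}

/-- The nonseparatedness kernel of `P`: the intersection of `contraMul I P` over all open right
ideals `I`, that is, the kernel of the completion map `P → lim P / contraMul I P`. -/
def nonseparatednessKernel (P : Contra R) : Set P.A :=
  {p | ∀ I : Submodule Rᵐᵒᵖ R, IsOpen (I : Set R) → p ∈ contraMul I P}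

variable (R)

/-- A left contramodule is separated if its completion map is injective, that is, if its
nonseparatedness kernel is zero. -/
def isSeparated : ObjectProperty (Contra R) :=
  fun P => nonseparatednessKernel P = {contraZero P}

/-- The full subcategory of separated left contramodules. -/
abbrev Separ : Type (u + 1) := (isSeparated R).FullSubcategory

end Monad

/-! ### Restriction of scalars -/

section Restriction

variable {R S : Type u}
  [Ring R] [UniformSpace R] [IsUniformAddGroup R] [IsTopologicalRing R]
  [CompleteSpace R] [T2Space R] [IsLinearTopology Rᵐᵒᵖ R]
  [Ring S] [UniformSpace S] [IsUniformAddGroup S] [IsTopologicalRing S]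
  [CompleteSpace S] [T2Space S] [IsLinearTopology Sᵐᵒᵖ S]

/-- The map `f[[X]] : R[[X]] → S[[X]]` applying `f` to every coefficient. -/
def ZeroFam.mapCoeff (f : R →+* S) (hf : Continuous f) {X : Type u} (a : ZeroFam R X) :
    ZeroFam S X :=
  ⟨fun x => f (a x), by simpa [Function.comp_def] using (hf.tendsto 0).comp a.2⟩

theorem mapCoeff_map (f : R →+* S) (hf : Continuous f) {X Y : Type u} (g : X → Y)
    (a : ZeroFam R X) :
    ZeroFam.mapCoeff f hf (ZeroFam.map g a) = ZeroFam.map g (ZeroFam.mapCoeff f hf a) :=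
  ZeroFam.ext' fun _ =>
    (summable_of_tendsto (tendsto_comp_val a.2 _)).map_tsum f hf

theorem mapCoeff_single (f : R →+* S) (hf : Continuous f) {X : Type u} (x : X) :
    ZeroFam.mapCoeff f hf (ZeroFam.single x) = ZeroFam.single x := by
  refine ZeroFam.ext' fun y => ?_
  by_cases h : y = x <;> simp [ZeroFam.mapCoeff, ZeroFam.single, h]

theorem mapCoeff_join (f : R →+* S) (hf : Continuous f) {X : Type u}
    (r : ZeroFam R (ZeroFam R X)) :
    ZeroFam.mapCoeff f hf (ZeroFam.join r) =
      ZeroFam.join (ZeroFam.mapCoeff f hf (ZeroFam.map (ZeroFam.mapCoeff f hf) r)) := by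
  rw [mapCoeff_map]
  refine ZeroFam.ext' fun x => ?_
  change f (∑' c : ZeroFam R X, r c * c x) =
    ∑' d, ZeroFam.map (ZeroFam.mapCoeff f hf) (ZeroFam.mapCoeff f hf r) d * d x
  rw [tsum_map_mul _ _ fun d : ZeroFam S X => d x,
    (summable_of_tendsto (tendsto_mul_right r.2 _)).map_tsum f hf]
  exact tsum_congr fun c => map_mul f _ _

/-- The morphism of monads `R[[-]] → S[[-]]` induced by a continuous ring homomorphism. -/
noncomputable def contraMonadHom (f : R →+* S) (hf : Continuous f) :
    contraMonad R ⟶ contraMonad S :=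
  MonadHom.mk
    { app := fun X => ↾(ZeroFam.mapCoeff f hf)
      naturality := fun X Y g => hom_ext fun a => mapCoeff_map f hf g a }
    (fun X => hom_ext fun x => mapCoeff_single f hf x)
    (fun X => hom_ext fun r => mapCoeff_join f hf r)

/-- Restriction of scalars `S-Contra ⥤ R-Contra` along a continuous ring homomorphism. -/
noncomputable def restrictContra (f : R →+* S) (hf : Continuous f) : Contra S ⥤ Contra R :=
  Monad.algebraFunctorOfMonadHom (contraMonadHom f hf)

theorem contraaction_restrictContra (f : R →+* S) (hf : Continuous f) (P : Contra S)
    (a : ZeroFam R P.A) :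
    contraaction ((restrictContra f hf).obj P) a = contraaction P (ZeroFam.mapCoeff f hf a) :=
  rfl

theorem contraZero_restrictContra (f : R →+* S) (hf : Continuous f) (P : Contra S) :
    contraZero ((restrictContra f hf).obj P) = contraZero P :=
  congrArg (contraaction P) (ZeroFam.ext' fun _ => map_zero f)

theorem contraZero_mem (P : Contra R) : contraZero P ∈ nonseparatednessKernel P :=
  fun I _ => ⟨ZeroFam.zero P.A, fun _ => I.zero_mem, rfl⟩

theorem nonseparatednessKernel_restrictContra (f : R →+* S) (hf : Continuous f) (P : Contra S)
    {p : P.A} (hp : p ∈ nonseparatednessKernel ((restrictContra f hf).obj P)) :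
    p ∈ nonseparatednessKernel P := by
  intro J hJ
  obtain ⟨I, hI, hIJ⟩ := (IsLinearTopology.hasBasis_open_submodule Rᵐᵒᵖ).mem_iff.1
    ((hJ.preimage hf).mem_nhds (show f 0 ∈ J by rw [map_zero]; exact J.zero_mem))
  obtain ⟨a, haI, hap⟩ := hp I hI
  exact ⟨ZeroFam.mapCoeff f hf a, fun x => hIJ (haI x), hap⟩

theorem isSeparated_restrictContra (f : R →+* S) (hf : Continuous f) (P : Contra S)
    (hP : isSeparated S P) : isSeparated R ((restrictContra f hf).obj P) := by
  refine Set.Subset.antisymm (fun p hp => ?_) (Set.singleton_subset_iff.2 (contraZero_mem _))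
  have h : p ∈ nonseparatednessKernel P := nonseparatednessKernel_restrictContra f hf P hp
  have hP' : nonseparatednessKernel P = {contraZero P} := hP
  rw [hP'] at h
  exact h.trans (contraZero_restrictContra f hf P).symm

/-- Restriction of scalars `S-Separ ⥤ R-Separ` along a continuous ring homomorphism. -/
noncomputable def restrictSepar (f : R →+* S) (hf : Continuous f) : Separ S ⥤ Separ R :=
  (isSeparated R).lift ((isSeparated S).ι ⋙ restrictContra f hf)
    fun P => isSeparated_restrictContra f hf P.obj P.property

end Restriction

/-! ### Strongly right taut maps and proepimorphisms -/

section Maps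

variable {R S : Type u} [Ring R] [TopologicalSpace R] [Ring S] [TopologicalSpace S]

/-- A ring map `f : R → S` is strongly right taut if the open two-sided ideals `I` of `R`, for
which the closure of the right ideal `f(I)S` is an open two-sided ideal of `S`, form a base of
neighbourhoods of zero in `R`. -/
def StronglyRightTaut (f : R →+* S) : Prop :=
  (𝓝 (0 : R)).HasBasis
    (fun I : TwoSidedIdeal R => IsOpen (I : Set R) ∧
      ∃ J : TwoSidedIdeal S, IsOpen (J : Set S) ∧
        (J : Set S) = closure (Submodule.span Sᵐᵒᵖ (f '' (I : Set R)) : Set S))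
    (fun I : TwoSidedIdeal R => (I : Set R))

/-- The ring map `R/I → S/J` induced by `f` when `f(I) ⊆ J`. -/
def quotientMap (f : R →+* S) (I : TwoSidedIdeal R) (J : TwoSidedIdeal S)
    (h : ∀ x ∈ I, f x ∈ J) : I.ringCon.Quotient →+* J.ringCon.Quotient :=
  I.ringCon.lift (J.ringCon.mk'.comp f) fun {x y} hxy => by
    refine (RingCon.eq J.ringCon).2 ((J.rel_iff _ _).2 ?_)
    rw [← map_sub]
    exact h _ ((I.rel_iff _ _).1 hxy)

/-- `f` is a topological ring proepimorphism if for all open two-sided ideals `I`, `J` with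
`f(I) ⊆ J` the induced map `R/I → S/J` is an epimorphism in the category of rings. -/
def IsProepimorphism (f : R →+* S) : Prop :=
  ∀ (I : TwoSidedIdeal R) (J : TwoSidedIdeal S), IsOpen (I : Set R) → IsOpen (J : Set S) →
    ∀ h : ∀ x ∈ I, f x ∈ J, Epi (RingCat.ofHom (quotientMap f I J h))

end Maps

end Contramodules

/-!
Restriction of scalars `f_♯` is always faithful, and it is full exactly when every map of separated
`S`-contramodules commuting with the contraactions of `R` commutes with those of `S`.

If `f` is a proepimorphism, then `R`-linear maps between `S`-modules annihilated by an open ideal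
are `S`-linear: conjugating `S → End(M × N)` by the shear `(m, n) ↦ (m, n + h m)` gives a second
ring map which agrees with the first on `f(R)`. Let `I n` be a decreasing base of open ideals of
`R` such that the closure `J n` of `f(I n)S` is an open ideal. Successive approximation, which
converges because `R` is complete, shows `J n ⋌ P = I n ⋌ f_♯ P` for separated `P`. Hence an
`R`-contramodule map `P → Q` descends to additive maps `P / (J n ⋌ P) → Q / (J n ⋌ Q)`, to which
the linearity statement applies, and `Q` is separated.

Conversely, two ring maps `S → T` with open kernels which agree on `f(R)` make the free
contramodule `T` over the discrete ring `T` into two separated `S`-contramodules with the same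
restriction to `R`. By fullness the identity of `T` is `S`-linear, so the two ring maps coincide.
-/

namespace Contramodules

/-! ### The module structure of `R[[X]]` -/

namespace ZeroFam

section Module

variable {R : Type u} [Ring R] [TopologicalSpace R] [IsTopologicalRing R] {X : Type u}

variable (R X) in
/-- The zero-convergent families of coefficients, as a submodule of `X → R`; the module structure
of `R[[X]]` is transported from it. -/
def zeroConvergent : Submodule R (X → R) where
  carrier := {a | Tendsto a cofinite (𝓝 0)}
  zero_mem' := tendsto_const_nhds
  add_mem' ha hb := by simpa using! ha.add hb
  smul_mem' r _ ha := by simpa using! ha.const_mul r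

/-- The bijection between `R[[X]]` and the module of zero-convergent families. -/
def equivZeroConvergent : ZeroFam R X ≃ zeroConvergent R X where
  toFun a := ⟨a, a.2⟩
  invFun a := ⟨a.1, a.2⟩

instance : AddCommGroup (ZeroFam R X) := equivZeroConvergent.addCommGroup

instance : Module R (ZeroFam R X) := equivZeroConvergent.module R

/-- The family of coefficients, as a linear map. -/
def coeffLinear : ZeroFam R X →ₗ[R] X → R :=
  (zeroConvergent R X).subtype ∘ₗ (equivZeroConvergent.linearEquiv R).toLinearMap

theorem sub_apply (a b : ZeroFam R X) (x : X) : (a - b) x = a x - b x := rfl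

theorem smul_apply (r : R) (a : ZeroFam R X) (x : X) : (r • a) x = r * a x := rfl

theorem sum_apply {ι : Type*} (s : Finset ι) (a : ι → ZeroFam R X) (x : X) :
    (∑ i ∈ s, a i) x = ∑ i ∈ s, a i x := by
  simpa only [Finset.sum_apply] using! congrFun (map_sum coeffLinear a s) x

variable (X) in
/-- The submodule `J[[X]]` of `R[[X]]` formed by the families all of whose coefficients lie in a
two-sided ideal `J`. -/
def coeffsIn (J : TwoSidedIdeal R) : Submodule R (ZeroFam R X) where
  carrier := {a | ∀ x, a x ∈ J}
  zero_mem' _ := J.zero_mem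
  add_mem' ha hb x := J.add_mem (ha x) (hb x)
  smul_mem' r _ ha x := J.mul_mem_left r _ (ha x)

theorem smul_mem_coeffsIn {J : TwoSidedIdeal R} {r : R} (hr : r ∈ J) (a : ZeroFam R X) :
    r • a ∈ coeffsIn X J :=
  fun _ => J.mul_mem_right _ _ hr

theorem sub_sum_smul_single_mem_coeffsIn {J : TwoSidedIdeal R} {a : ZeroFam R X} {s : Finset X}
    (h : ∀ x ∉ s, a x ∈ J) : a - ∑ x ∈ s, a x • single x ∈ coeffsIn X J := by
  classical
  intro x
  have hsum : (∑ y ∈ s, a y • single y) x = if x ∈ s then a x else 0 := by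
    simp [sum_apply, smul_apply, single]
  rw [sub_apply, hsum]
  split_ifs with hx
  · simp
  · simpa using h x hx

end Module

theorem exists_finset_forall_notMem_mem {R : Type u} [Ring R] [TopologicalSpace R] {X : Type u}
    {J : TwoSidedIdeal R} (hJ : IsOpen (J : Set R)) (a : ZeroFam R X) :
    ∃ s : Finset X, ∀ x ∉ s, a x ∈ J :=
  have hfin := eventually_cofinite.1 (a.2.eventually_mem (hJ.mem_nhds J.zero_mem))
  ⟨hfin.toFinset, fun x hx => by simpa using hx⟩

end ZeroFam

theorem isClosed_of_isOpen {R : Type*} [Ring R] [TopologicalSpace R] [ContinuousAdd R]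
    {J : TwoSidedIdeal R} (hJ : IsOpen (J : Set R)) : IsClosed (J : Set R) :=
  (AddSubgroup.ofClass J).isClosed_of_isOpen hJ

namespace ZeroFam

section Functoriality

variable {R : Type u} [Ring R] [UniformSpace R] [IsUniformAddGroup R] [IsTopologicalRing R]
  [CompleteSpace R] [T2Space R] [IsLinearTopology Rᵐᵒᵖ R] {X Y : Type u}

/-- `R[[g]]` as a linear map. -/
noncomputable def mapLinear (g : X → Y) : ZeroFam R X →ₗ[R] ZeroFam R Y where
  toFun := map g
  map_add' a b := ZeroFam.ext' fun _ => (summable_of_tendsto (tendsto_comp_val a.2 _)).tsum_add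
    (summable_of_tendsto (tendsto_comp_val b.2 _))
  map_smul' r a := ZeroFam.ext' fun _ =>
    (summable_of_tendsto (tendsto_comp_val a.2 _)).tsum_mul_left r

theorem mapLinear_single (g : X → Y) (x : X) :
    mapLinear g (single x : ZeroFam R X) = single (g x) :=
  map_single g x

/-- The opening of parentheses `R[[R[[X]]]] → R[[X]]` as a linear map. -/
noncomputable def joinLinear : ZeroFam R (ZeroFam R X) →ₗ[R] ZeroFam R X where
  toFun := join
  map_add' a b := ZeroFam.ext' fun x => by
    change ∑' c : ZeroFam R X, (a c + b c) * c x = _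
    simp only [add_mul]
    exact (summable_of_tendsto (tendsto_mul_right a.2 _)).tsum_add
      (summable_of_tendsto (tendsto_mul_right b.2 _))
  map_smul' r a := ZeroFam.ext' fun x => by
    change ∑' c : ZeroFam R X, (r * a c) * c x = _
    simp only [mul_assoc]
    exact (summable_of_tendsto (tendsto_mul_right a.2 _)).tsum_mul_left r

theorem map_mem_coeffsIn {J : TwoSidedIdeal R} (hJ : IsOpen (J : Set R)) (g : X → Y)
    {a : ZeroFam R X} (ha : a ∈ coeffsIn X J) : map g a ∈ coeffsIn Y J :=
  fun _ => _root_.tsum_mem (isClosed_of_isOpen hJ) fun x => ha x.1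

theorem exists_forall_sub_sum_mem_coeffsIn {I : ℕ → TwoSidedIdeal R}
    (hI : (𝓝 (0 : R)).HasAntitoneBasis fun n => (I n : Set R)) (hIo : ∀ n, IsOpen (I n : Set R))
    {a : ℕ → ZeroFam R X} (ha : ∀ k, a k ∈ coeffsIn X (I k)) :
    ∃ b : ZeroFam R X, ∀ m, b - ∑ k ∈ Finset.range m, a k ∈ coeffsIn X (I m) := by
  have ha_of_le {m k : ℕ} (hmk : m ≤ k) (x : X) : a k x ∈ I m := hI.2 hmk (ha k x)
  have hsummable (x : X) : Summable fun k => a k x := by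
    refine summable_of_tendsto ?_
    rw [Nat.cofinite_eq_atTop, hI.1.tendsto_right_iff]
    exact fun m _ => (eventually_ge_atTop m).mono fun k hk => ha_of_le hk x
  have htendsto : Tendsto (fun x => ∑' k, a k x) cofinite (𝓝 0) := by
    refine tendsto_zero_iff.2 fun U hU => ?_
    obtain ⟨m, -, hmU⟩ := hI.1.mem_iff.1 (hU.mem_nhds U.zero_mem)
    refine ((Finset.range m).finite_toSet.biUnion fun k _ =>
      tendsto_zero_iff.1 (a k).2 U hU).subset fun x hx => ?_
    by_contra hx'
    simp only [Finset.coe_range, Set.mem_iUnion, Set.mem_Iio, Set.mem_ofPred_eq, not_exists,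
      not_not] at hx'
    exact hx (tsum_mem hU fun k =>
      (lt_or_ge k m).elim (hx' k) fun hk => hmU (ha_of_le hk x))
  refine ⟨⟨_, htendsto⟩, fun m x => ?_⟩
  rw [sub_apply, sum_apply]
  change ∑' k, a k x - ∑ k ∈ Finset.range m, a k x ∈ I m
  rw [← (hsummable x).sum_add_tsum_nat_add m, add_sub_cancel_left]
  exact _root_.tsum_mem (isClosed_of_isOpen (hIo m)) fun k => ha_of_le (Nat.le_add_left m k) x

end Functoriality

section MapCoeff

variable {R S : Type u} [Ring R] [UniformSpace R] [IsTopologicalRing R]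
  [Ring S] [UniformSpace S] [IsTopologicalRing S]

/-- The coefficientwise application of a continuous ring homomorphism, as a semilinear map. -/
def mapCoeffLinear (f : R →+* S) (hf : Continuous f) (X : Type u) :
    ZeroFam R X →ₛₗ[f] ZeroFam S X where
  toFun := mapCoeff f hf
  map_add' _ _ := ZeroFam.ext' fun _ => map_add f _ _
  map_smul' _ _ := ZeroFam.ext' fun _ => map_mul f _ _

theorem mapCoeffLinear_single (f : R →+* S) (hf : Continuous f) {X : Type u} (x : X) :
    mapCoeffLinear f hf X (single x) = single x :=
  ZeroFam.ext' fun y => by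
    by_cases h : y = x <;> simp [mapCoeffLinear, mapCoeff, single, h]

end MapCoeff

end ZeroFam

open ZeroFam

/-! ### The module underlying a contramodule -/

section ModuleStructure

variable {R : Type u} [Ring R] [UniformSpace R] [IsUniformAddGroup R] [IsTopologicalRing R]
  [CompleteSpace R] [T2Space R] [IsLinearTopology Rᵐᵒᵖ R]

theorem contraaction_single (P : Contra R) (p : P.A) : contraaction P (single p) = p :=
  ConcreteCategory.congr_hom P.unit p

theorem contraaction_join (P : Contra R) (r : ZeroFam R (ZeroFam R P.A)) :
    contraaction P (join r) = contraaction P (map (contraaction P) r) :=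
  ConcreteCategory.congr_hom P.assoc r

theorem contraaction_surjective (P : Contra R) : Function.Surjective (contraaction P) :=
  fun p => ⟨single p, contraaction_single P p⟩

variable (P : Contra R)

noncomputable instance : Zero P.A := ⟨contraaction P 0⟩

noncomputable instance : Add P.A := ⟨fun p q => contraaction P (single p + single q)⟩

noncomputable instance : SMul R P.A := ⟨fun r p => contraaction P (r • single p)⟩

theorem contraaction_add (a b : ZeroFam R P.A) :
    contraaction P (a + b) = contraaction P a + contraaction P b :=
  calc contraaction P (a + b)
      = contraaction P (joinLinear (single a + single b)) := by
        rw [map_add]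
        exact congrArg (contraaction P) (congrArg₂ _ (join_single a).symm (join_single b).symm)
    _ = contraaction P (mapLinear (contraaction P) (single a + single b)) := contraaction_join P _
    _ = contraaction P a + contraaction P b := by
        rw [map_add]
        exact congrArg (contraaction P) (congrArg₂ _ (map_single _ a) (map_single _ b))

theorem contraaction_smul (r : R) (a : ZeroFam R P.A) :
    contraaction P (r • a) = r • contraaction P a :=
  calc contraaction P (r • a)
      = contraaction P (joinLinear (r • single a)) := by
        rw [map_smul]
        exact congrArg (contraaction P) (congrArg (r • ·) (join_single a).symm)
    _ = contraaction P (mapLinear (contraaction P) (r • single a)) := contraaction_join P _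
    _ = r • contraaction P a := by
        rw [map_smul]
        exact congrArg (contraaction P) (congrArg (r • ·) (map_single _ a))

noncomputable instance : AddCommMonoid P.A :=
  letI : SMul ℕ P.A := ⟨fun n p => (n : R) • p⟩
  (contraaction_surjective P).addCommMonoid _ rfl (contraaction_add P) fun a n => by
    rw [← Nat.cast_smul_eq_nsmul R, contraaction_smul]
    rfl

noncomputable instance : Module R P.A :=
  (contraaction_surjective P).module R ⟨⟨contraaction P, rfl⟩, contraaction_add P⟩
    (contraaction_smul P)

noncomputable instance : AddCommGroup P.A := Module.addCommMonoidToAddCommGroup R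

/-- The contraaction map as a linear map. -/
noncomputable def contraactionLinear : ZeroFam R P.A →ₗ[R] P.A where
  toFun := contraaction P
  map_add' := contraaction_add P
  map_smul' := contraaction_smul P

/-- The submodule `J ⋌ P` of a contramodule `P` for a two-sided ideal `J`: the image of `J[[P]]`
under the contraaction. -/
noncomputable def idealMul (J : TwoSidedIdeal R) : Submodule R P.A :=
  (coeffsIn P.A J).map (contraactionLinear P)

variable {P}

theorem contraaction_mem_idealMul {J : TwoSidedIdeal R} {a : ZeroFam R P.A}
    (ha : a ∈ coeffsIn P.A J) : contraaction P a ∈ idealMul P J :=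
  Submodule.mem_map_of_mem ha

theorem smul_mem_idealMul {J : TwoSidedIdeal R} {r : R} (hr : r ∈ J) (p : P.A) :
    r • p ∈ idealMul P J :=
  contraaction_mem_idealMul (smul_mem_coeffsIn hr (single p))

theorem contraaction_map_smodEq_sum {X : Type u} {J : TwoSidedIdeal R} (hJ : IsOpen (J : Set R))
    {a : ZeroFam R X} {s : Finset X} (h : ∀ x ∉ s, a x ∈ J) (g : X → P.A) :
    contraaction P (map g a) ≡ ∑ x ∈ s, a x • g x [SMOD idealMul P J] := by
  have hsingle (x : X) : contraactionLinear P (mapLinear g (single x)) = g x :=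
    mapLinear_single (R := R) g x ▸ contraaction_single P (g x)
  have hsum : ∑ x ∈ s, a x • g x =
      contraactionLinear P (mapLinear g (∑ x ∈ s, a x • single x)) := by
    simp only [map_sum, map_smul, hsingle]
  rw [SModEq.sub_mem, hsum]
  change contraactionLinear P (mapLinear g a) - _ ∈ _
  rw [← map_sub, ← map_sub]
  exact contraaction_mem_idealMul
    (map_mem_coeffsIn hJ g (sub_sum_smul_single_mem_coeffsIn h))

theorem contraaction_smodEq_sum {J : TwoSidedIdeal R} (hJ : IsOpen (J : Set R))
    {a : ZeroFam R P.A} {s : Finset P.A} (h : ∀ p ∉ s, a p ∈ J) :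
    contraaction P a ≡ ∑ p ∈ s, a p • p [SMOD idealMul P J] := by
  simpa only [Contramodules.map_id, id] using contraaction_map_smodEq_sum hJ h id

theorem eq_of_forall_smodEq_idealMul (hP : isSeparated R P) {ι : Type*} {J : ι → TwoSidedIdeal R}
    (hJ : ∀ U : Submodule Rᵐᵒᵖ R, IsOpen (U : Set R) → ∃ i, (J i : Set R) ⊆ U) {p q : P.A}
    (hpq : ∀ i, p ≡ q [SMOD idealMul P (J i)]) : p = q := by
  have hker : p - q ∈ nonseparatednessKernel P := fun U hU => by
    obtain ⟨i, hi⟩ := hJ U hU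
    obtain ⟨a, ha, hapq⟩ := SModEq.sub_mem.1 (hpq i)
    exact ⟨a, fun x => hi (ha x), hapq⟩
  rw [show nonseparatednessKernel P = {contraZero P} from hP] at hker
  exact sub_eq_zero.1 hker

end ModuleStructure

/-! ### Proepimorphisms and modules -/

section Proepimorphism

variable {R S : Type u} [Ring R] [TopologicalSpace R] [Ring S] [TopologicalSpace S] {f : R →+* S}

theorem isOpen_ker_of_forall_mem [ContinuousAdd S] {T : Type*} [Ring T] {J : TwoSidedIdeal S}
    (hJ : IsOpen (J : Set S)) {χ : S →+* T} (hχ : ∀ s ∈ J, χ s = 0) :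
    IsOpen (TwoSidedIdeal.ker χ : Set S) :=
  AddSubgroup.isOpen_mono (H₁ := .ofClass J) (H₂ := .ofClass (TwoSidedIdeal.ker χ))
    (fun s hs => (TwoSidedIdeal.mem_ker χ).2 (hχ s hs)) hJ

theorem IsProepimorphism.ringHom_ext [ContinuousAdd S] (hf : Continuous f)
    (h : IsProepimorphism f) {T : Type u} [Ring T] {φ ψ : S →+* T}
    (hφ : IsOpen (TwoSidedIdeal.ker φ : Set S)) (hψ : IsOpen (TwoSidedIdeal.ker ψ : Set S))
    (hφψ : φ.comp f = ψ.comp f) : φ = ψ := by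
  let J := TwoSidedIdeal.ker φ ⊓ TwoSidedIdeal.ker ψ
  have hJ : IsOpen (J : Set S) := hφ.inter hψ
  have hI : IsOpen (J.comap f : Set R) := by
    rw [show (J.comap f : Set R) = f ⁻¹' J from Set.ext fun _ => TwoSidedIdeal.mem_comap f]
    exact hJ.preimage hf
  have hJφ : J.ringCon ≤ RingCon.ker φ := fun {_ _} h => h.1
  have hJψ : J.ringCon ≤ RingCon.ker ψ := fun {_ _} h => h.2
  have := h (J.comap f) J hI hJ fun _ => (TwoSidedIdeal.mem_comap f).1
  have hlift : RingCat.ofHom (J.ringCon.lift φ hJφ) = RingCat.ofHom (J.ringCon.lift ψ hJψ) := by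
    rw [← cancel_epi (RingCat.ofHom (quotientMap f (J.comap f) J _))]
    ext r
    exact RingHom.congr_fun hφψ r
  ext s
  exact RingHom.congr_fun (congrArg RingCat.Hom.hom hlift) (J.ringCon.mk' s)

theorem isProepimorphism_of_ringHom_ext [ContinuousAdd S]
    (h : ∀ (T : Type u) [Ring T] (φ ψ : S →+* T), IsOpen (TwoSidedIdeal.ker φ : Set S) →
      IsOpen (TwoSidedIdeal.ker ψ : Set S) → φ.comp f = ψ.comp f → φ = ψ) :
    IsProepimorphism f := by
  refine fun I J _ hJ hIJ => ⟨fun {T} g g' hgg' => ?_⟩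
  have hker (χ : J.ringCon.Quotient →+* T) :
      IsOpen (TwoSidedIdeal.ker (χ.comp J.ringCon.mk') : Set S) :=
    isOpen_ker_of_forall_mem hJ fun s hs => by
      rw [RingHom.comp_apply, show J.ringCon.mk' s = 0 from (RingCon.eq J.ringCon).2 hs, map_zero]
  have hcomp := h T (g.hom.comp J.ringCon.mk') (g'.hom.comp J.ringCon.mk') (hker _) (hker _)
    (RingHom.ext fun r => RingHom.congr_fun (congrArg RingCat.Hom.hom hgg') (I.ringCon.mk' r))
  ext s
  exact RingHom.congr_fun hcomp s

protected theorem IsProepimorphism.map_smul [ContinuousAdd S] (hf : Continuous f)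
    (hfe : IsProepimorphism f) {J : TwoSidedIdeal S} (hJ : IsOpen (J : Set S)) {M N : Type u}
    [AddCommGroup M] [Module S M] [AddCommGroup N] [Module S N]
    (hM : ∀ s ∈ J, ∀ m : M, s • m = 0) (hN : ∀ s ∈ J, ∀ n : N, s • n = 0)
    (h : M →+ N) (hh : ∀ r m, h (f r • m) = f r • h m) (s : S) (m : M) :
    h (s • m) = s • h m := by
  -- The shear `(m, n) ↦ (m, n + h m)` commutes with the action of `s` exactly when `h` does.
  let e : (M × N) ≃ₗ[ℤ] M × N :=
    (LinearEquiv.refl ℤ M).skewProd (LinearEquiv.refl ℤ N) h.toIntLinearMap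
  let φ : S →+* Module.End ℤ (M × N) := Module.toModuleEnd ℤ (M × N)
  let ψ : S →+* Module.End ℤ (M × N) := (e.conjRingEquiv : _ →+* _).comp φ
  have hφ (s : S) (x : M × N) : φ s x = (s • x.1, s • x.2) := rfl
  have hψ (s : S) (x : M × N) : ψ s x = (s • x.1, s • (x.2 - h x.1) + h (s • x.1)) := rfl
  have hφJ (s : S) (hs : s ∈ J) : φ s = 0 :=
    LinearMap.ext fun x => Prod.ext (hM s hs x.1) (hN s hs x.2)
  have hψJ (s : S) (hs : s ∈ J) : ψ s = 0 := by simp [ψ, hφJ s hs]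
  have hψφ : ψ = φ := hfe.ringHom_ext hf (isOpen_ker_of_forall_mem hJ hψJ)
    (isOpen_ker_of_forall_mem hJ hφJ) (RingHom.ext fun r => LinearMap.ext fun x => by
      simp [hφ, hψ, hh, smul_sub])
  simpa [hφ, hψ] using congrArg Prod.snd (LinearMap.congr_fun (RingHom.congr_fun hψφ s) (m, h m))

end Proepimorphism

/-! ### Strongly right taut maps -/

section TautBasis

variable {R S : Type u} [Ring R] [TopologicalSpace R] [Ring S] [TopologicalSpace S]

/-- A decreasing base of neighbourhoods of zero in `R` formed by open two-sided ideals `I n` such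
that the closure of `f(I n)S` is an open two-sided ideal `J n`. -/
structure TautBasis (f : R →+* S) (I : ℕ → TwoSidedIdeal R) (J : ℕ → TwoSidedIdeal S) : Prop where
  basis : (𝓝 (0 : R)).HasAntitoneBasis fun n => (I n : Set R)
  isOpen_left : ∀ n, IsOpen (I n : Set R)
  isOpen_right : ∀ n, IsOpen (J n : Set S)
  eq_closure : ∀ n,
    (J n : Set S) = closure (Submodule.span Sᵐᵒᵖ (f '' (I n : Set R)) : Set S)

variable {f : R →+* S} {I : ℕ → TwoSidedIdeal R} {J : ℕ → TwoSidedIdeal S}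

theorem StronglyRightTaut.exists_tautBasis (h : StronglyRightTaut f)
    (hR : (𝓝 (0 : R)).IsCountablyGenerated) : ∃ I J, TautBasis f I J := by
  obtain ⟨I, hI, hbasis⟩ := HasBasis.exists_antitone_subbasis h
  choose hIo J hJo hJ using hI
  exact ⟨I, J, hbasis, hIo, hJo, hJ⟩

namespace TautBasis

theorem shift (h : TautBasis f I J) (n : ℕ) :
    TautBasis f (fun k => I (n + k)) fun k => J (n + k) where
  basis := h.basis.comp_strictMono (add_right_strictMono (a := n))
  isOpen_left _ := h.isOpen_left _
  isOpen_right _ := h.isOpen_right _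
  eq_closure _ := h.eq_closure _

theorem map_mem (h : TautBasis f I J) {n : ℕ} {r : R} (hr : r ∈ I n) : f r ∈ J n :=
  (h.eq_closure n).superset (subset_closure (Submodule.subset_span (Set.mem_image_of_mem f hr)))

theorem exists_subset [ContinuousAdd S] (h : TautBasis f I J) (hf : Continuous f)
    (U : Submodule Sᵐᵒᵖ S) (hU : IsOpen (U : Set S)) :
    ∃ n, (J n : Set S) ⊆ U := by
  obtain ⟨n, -, hn⟩ := h.basis.1.mem_iff.1
    ((hU.preimage hf).mem_nhds (show f 0 ∈ U from (map_zero f).symm ▸ U.zero_mem))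
  refine ⟨n, (h.eq_closure n).subset.trans (closure_minimal ?_ ?_)⟩
  · exact Submodule.span_le.2 (Set.image_subset_iff.2 hn)
  · exact U.toAddSubgroup.isClosed_of_isOpen hU

end TautBasis

end TautBasis

section Taut

variable {R S : Type u} [Ring R] [UniformSpace R] [IsTopologicalRing R]
  [Ring S] [UniformSpace S] [IsUniformAddGroup S] [IsTopologicalRing S]
  [CompleteSpace S] [T2Space S] [IsLinearTopology Sᵐᵒᵖ S] (f : R →+* S) (hf : Continuous f)

/-- The contraaction `R[[P]] → P` of the restriction of scalars `f_♯ P`, as a semilinear map with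
values in the `S`-module `P`. -/
noncomputable def restrictAction (P : Contra S) : ZeroFam R P.A →ₛₗ[f] P.A :=
  (contraactionLinear P).comp (mapCoeffLinear f hf P.A)

theorem restrictAction_single (P : Contra S) (p : P.A) :
    restrictAction f hf P (single p) = p :=
  (congrArg (contraaction P) (mapCoeffLinear_single f hf p)).trans (contraaction_single P p)

theorem restrictAction_smul_single (P : Contra S) (r : R) (p : P.A) :
    restrictAction f hf P (r • single p) = f r • p := by
  rw [map_smulₛₗ, restrictAction_single]

/-- The subgroup `I ⋌ f_♯ P` of an `S`-contramodule `P` for a two-sided ideal `I` of `R`. -/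
noncomputable def restrictMul (P : Contra S) (I : TwoSidedIdeal R) : AddSubgroup P.A :=
  (coeffsIn P.A I).toAddSubgroup.map (restrictAction f hf P).toAddMonoidHom

variable {f} {I : TwoSidedIdeal R}

theorem smul_mem_restrictMul {s : S} (hs : s ∈ Submodule.span Sᵐᵒᵖ (f '' (I : Set R)))
    {P : Contra S} (p : P.A) : s • p ∈ restrictMul f hf P I := by
  induction hs using Submodule.span_induction generalizing p with
  | mem s hs =>
    obtain ⟨r, hr, rfl⟩ := hs
    exact ⟨r • single p, smul_mem_coeffsIn hr _, restrictAction_smul_single f hf P r p⟩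
  | zero => simpa only [zero_smul] using zero_mem _
  | add s t _ _ hs ht => simpa only [add_smul] using add_mem (hs p) (ht p)
  | smul t s _ hs => simpa only [MulOpposite.smul_eq_mul_unop, mul_smul] using hs (t.unop • p)

variable {J J' : TwoSidedIdeal S}

theorem smul_mem_restrictMul_sup {s : S}
    (hs : s ∈ closure (Submodule.span Sᵐᵒᵖ (f '' (I : Set R)) : Set S))
    (hJ' : IsOpen (J' : Set S)) {P : Contra S} (p : P.A) :
    s • p ∈ restrictMul f hf P I ⊔ (idealMul P J').toAddSubgroup := by
  obtain ⟨t, hst, ht⟩ := mem_closure_iff.1 hs ((s - ·) ⁻¹' J')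
    (hJ'.preimage (continuous_const.sub continuous_id)) (by simp)
  rw [← add_sub_cancel t s, add_smul]
  exact add_mem (AddSubgroup.mem_sup_left (smul_mem_restrictMul hf ht p))
    (AddSubgroup.mem_sup_right (smul_mem_idealMul hst p))

theorem exists_smodEq_restrictAction
    (hJ : (J : Set S) ⊆ closure (Submodule.span Sᵐᵒᵖ (f '' (I : Set R)) : Set S))
    (hJ' : IsOpen (J' : Set S)) {P : Contra S} {p : P.A} (hp : p ∈ idealMul P J) :
    ∃ a ∈ coeffsIn P.A I, p ≡ restrictAction f hf P a [SMOD idealMul P J'] := by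
  obtain ⟨c, hc, rfl⟩ := hp
  obtain ⟨s, hs⟩ := exists_finset_forall_notMem_mem hJ' c
  have hsum : ∑ q ∈ s, c q • q ∈ restrictMul f hf P I ⊔ (idealMul P J').toAddSubgroup :=
    sum_mem fun q _ => smul_mem_restrictMul_sup hf (hJ (hc q)) hJ' q
  obtain ⟨_, ⟨a, ha, rfl⟩, q, hq, hsum⟩ := AddSubgroup.mem_sup.1 hsum
  refine ⟨a, ha, (contraaction_smodEq_sum hJ' hs).trans ?_⟩
  rw [← hsum, SModEq.sub_mem]
  exact (add_sub_cancel_left _ q).symm ▸ hq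

namespace TautBasis

variable {I : ℕ → TwoSidedIdeal R} {J : ℕ → TwoSidedIdeal S}

theorem restrictAction_mem_idealMul (h : TautBasis f I J) {P : Contra S} {n : ℕ}
    {a : ZeroFam R P.A} (ha : a ∈ coeffsIn P.A (I n)) :
    restrictAction f hf P a ∈ idealMul P (J n) :=
  Submodule.mem_map_of_mem fun p => h.map_mem (ha p)

theorem exists_seq_smodEq_sum (h : TautBasis f I J) {P : Contra S} {p : P.A}
    (hp : p ∈ idealMul P (J 0)) :
    ∃ a : ℕ → ZeroFam R P.A, (∀ k, a k ∈ coeffsIn P.A (I k)) ∧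
      ∀ m, p ≡ restrictAction f hf P (∑ k ∈ Finset.range m, a k) [SMOD idealMul P (J m)] := by
  have approx (k : ℕ) (q : idealMul P (J k)) : ∃ a ∈ coeffsIn P.A (I k),
      q - restrictAction f hf P a ∈ idealMul P (J (k + 1)) := by
    simpa only [SModEq.sub_mem] using exists_smodEq_restrictAction hf (h.eq_closure k).subset
      (h.isOpen_right (k + 1)) q.2
  choose a haI ha using approx
  let remainder (k : ℕ) : idealMul P (J k) := Nat.rec ⟨p, hp⟩ (fun k q => ⟨_, ha k q⟩) k
  have hremainder (m : ℕ) : p - restrictAction f hf P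
      (∑ k ∈ Finset.range m, a k (remainder k)) = (remainder m).1 := by
    induction m with
    | zero => simp [remainder]
    | succ m ih => rw [Finset.sum_range_succ, map_add, ← sub_sub, ih]
  exact ⟨fun k => a k (remainder k), fun k => haI k _,
    fun m => SModEq.sub_mem.2 (hremainder m ▸ (remainder m).2)⟩

section Complete

variable [IsUniformAddGroup R] [CompleteSpace R] [T2Space R] [IsLinearTopology Rᵐᵒᵖ R]

theorem idealMul_zero_le_restrictMul (h : TautBasis f I J) {P : Contra S} (hP : isSeparated S P) :
    (idealMul P (J 0)).toAddSubgroup ≤ restrictMul f hf P (I 0) := by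
  intro p hp
  obtain ⟨a, haI, ha⟩ := h.exists_seq_smodEq_sum hf hp
  obtain ⟨b, hb⟩ := exists_forall_sub_sum_mem_coeffsIn h.basis h.isOpen_left haI
  have hpb : p = restrictAction f hf P b :=
    eq_of_forall_smodEq_idealMul hP (h.exists_subset hf) fun m => (ha m).trans <| .symm <|
      SModEq.sub_mem.2 (map_sub (restrictAction f hf P) _ _ ▸
        h.restrictAction_mem_idealMul hf (hb m))
  exact ⟨b, by simpa using hb 0, hpb.symm⟩

theorem idealMul_le_restrictMul (h : TautBasis f I J) {P : Contra S} (hP : isSeparated S P)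
    (n : ℕ) : (idealMul P (J n)).toAddSubgroup ≤ restrictMul f hf P (I n) :=
  (h.shift n).idealMul_zero_le_restrictMul hf hP

end Complete

end TautBasis

end Taut

/-! ### Full faithfulness -/

section FullyFaithful

variable {R S : Type u}
  [Ring R] [UniformSpace R] [IsUniformAddGroup R] [IsTopologicalRing R]
  [CompleteSpace R] [T2Space R] [IsLinearTopology Rᵐᵒᵖ R]
  [Ring S] [UniformSpace S] [IsUniformAddGroup S] [IsTopologicalRing S]
  [CompleteSpace S] [T2Space S] [IsLinearTopology Sᵐᵒᵖ S]

/-- A map of underlying sets is a morphism of contramodules if it commutes with the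
contraactions. -/
def IsContraHom (P Q : Contra R) (g : P.A → Q.A) : Prop :=
  ∀ a, g (contraaction P a) = contraaction Q (map g a)

variable {f : R →+* S} (hf : Continuous f)

theorem restrictSepar_full_iff : (restrictSepar f hf).Full ↔
    ∀ (P Q : Separ S) (g : P.obj.A → Q.obj.A),
      IsContraHom ((restrictContra f hf).obj P.obj) ((restrictContra f hf).obj Q.obj) g →
        IsContraHom P.obj Q.obj g := by
  refine ⟨fun h P Q g hg => ?_, fun h => ⟨fun {P Q} u => ?_⟩⟩
  · let u : (restrictSepar f hf).obj P ⟶ (restrictSepar f hf).obj Q :=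
      ObjectProperty.homMk ⟨↾g, Contramodules.hom_ext fun a => (hg a).symm⟩
    obtain ⟨v, hv⟩ := h.map_surjective u
    have hvg : v.hom.f = ↾g := congrArg (fun w => w.hom.f) hv
    have hcomm := v.hom.h
    rw [hvg] at hcomm
    exact fun a => (ConcreteCategory.congr_hom hcomm a).symm
  · have hg := h P Q (ConcreteCategory.hom u.hom.f) fun a =>
      (ConcreteCategory.congr_hom u.hom.h a).symm
    exact ⟨ObjectProperty.homMk ⟨u.hom.f, Contramodules.hom_ext fun a => (hg a).symm⟩, rfl⟩

theorem restrictSepar_faithful : (restrictSepar f hf).Faithful where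
  map_injective huv :=
    ObjectProperty.hom_ext _ (Monad.Algebra.Hom.ext (congrArg (fun w => w.hom.f) huv))

namespace IsContraHom

variable {hf} {P Q : Contra S} {g : P.A → Q.A}
  (hg : IsContraHom ((restrictContra f hf).obj P) ((restrictContra f hf).obj Q) g)

include hg

theorem map_restrictAction (a : ZeroFam R P.A) :
    g (restrictAction f hf P a) = restrictAction f hf Q (mapLinear g a) :=
  hg a

protected theorem map_add (p q : P.A) : g (p + q) = g p + g q := by
  have h := hg.map_restrictAction (single p + single q)
  rwa [map_add, map_add, map_add, mapLinear_single, mapLinear_single,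
    restrictAction_single, restrictAction_single, restrictAction_single,
    restrictAction_single] at h

protected theorem map_smul (r : R) (p : P.A) : g (f r • p) = f r • g p := by
  have h := hg.map_restrictAction (r • single p)
  rwa [map_smul (mapLinear g), mapLinear_single, restrictAction_smul_single,
    restrictAction_smul_single] at h

variable {I : ℕ → TwoSidedIdeal R} {J : ℕ → TwoSidedIdeal S} (hIJ : TautBasis f I J)
  (hP : isSeparated S P)

include hIJ hP

theorem map_mem_idealMul {n : ℕ} {p : P.A} (hp : p ∈ idealMul P (J n)) :
    g p ∈ idealMul Q (J n) := by
  obtain ⟨a, ha, rfl⟩ := hIJ.idealMul_le_restrictMul hf hP n hp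
  change g (restrictAction f hf P a) ∈ idealMul Q (J n)
  rw [hg.map_restrictAction]
  exact hIJ.restrictAction_mem_idealMul hf (map_mem_coeffsIn (hIJ.isOpen_left n) g ha)

theorem map_smodEq {n : ℕ} {p q : P.A} (hpq : p ≡ q [SMOD idealMul P (J n)]) :
    g p ≡ g q [SMOD idealMul Q (J n)] := by
  rw [SModEq.sub_mem] at hpq ⊢
  rw [show g p - g q = g (p - q) from (map_sub (AddMonoidHom.mk' g hg.map_add) p q).symm]
  exact hg.map_mem_idealMul hIJ hP hpq

variable (hfe : IsProepimorphism f)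

include hfe

theorem map_smul_smodEq (n : ℕ) (s : S) (p : P.A) :
    g (s • p) ≡ s • g p [SMOD idealMul Q (J n)] := by
  let gbar : (P.A ⧸ idealMul P (J n)) →+ (Q.A ⧸ idealMul Q (J n)) :=
    QuotientAddGroup.map (idealMul P (J n)).toAddSubgroup (idealMul Q (J n)).toAddSubgroup
      (AddMonoidHom.mk' g hg.map_add) fun _ hp => hg.map_mem_idealMul hIJ hP hp
  have smul_eq_zero (P : Contra S) (s : S) (hs : s ∈ J n) (x : P.A ⧸ idealMul P (J n)) :
      s • x = 0 :=
    x.induction_on fun p => (Submodule.Quotient.mk_eq_zero _).2 (smul_mem_idealMul hs p)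
  refine hfe.map_smul hf (hIJ.isOpen_right n) (smul_eq_zero P) (smul_eq_zero Q) gbar
    (fun r x => ?_) s (Submodule.Quotient.mk p)
  obtain ⟨q, rfl⟩ := Submodule.Quotient.mk_surjective _ x
  exact congrArg Submodule.Quotient.mk (hg.map_smul r q)

theorem of_isProepimorphism (hQ : isSeparated S Q) : IsContraHom P Q g := by
  refine fun b => eq_of_forall_smodEq_idealMul hQ (hIJ.exists_subset hf) fun n => ?_
  obtain ⟨s, hs⟩ := exists_finset_forall_notMem_mem (hIJ.isOpen_right n) b
  calc g (contraaction P b)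
      ≡ g (∑ p ∈ s, b p • p) [SMOD idealMul Q (J n)] :=
        hg.map_smodEq hIJ hP (contraaction_smodEq_sum (hIJ.isOpen_right n) hs)
    _ = ∑ p ∈ s, g (b p • p) :=
        map_sum (AddMonoidHom.mk' g hg.map_add) (fun p => b p • p) s
    _ ≡ ∑ p ∈ s, b p • g p [SMOD idealMul Q (J n)] :=
        SModEq.sum fun p _ => hg.map_smul_smodEq hIJ hP hfe n (b p) p
    _ ≡ contraaction Q (map g b) [SMOD idealMul Q (J n)] :=
        (contraaction_map_smodEq_sum (hIJ.isOpen_right n) hs g).symm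

end IsContraHom

theorem IsProepimorphism.restrictSepar_full (hfe : IsProepimorphism f)
    (htaut : StronglyRightTaut f) (hR : (𝓝 (0 : R)).IsCountablyGenerated) :
    (restrictSepar f hf).Full := by
  obtain ⟨I, J, hIJ⟩ := htaut.exists_tautBasis hR
  exact (restrictSepar_full_iff hf).2 fun P Q _ hg =>
    hg.of_isProepimorphism hIJ P.property hfe Q.property

theorem isSeparated_of_discreteTopology [DiscreteTopology S] (P : Contra S) :
    isSeparated S P := by
  refine Set.Subset.antisymm (fun p hp => ?_) (Set.singleton_subset_iff.2 (contraZero_mem P))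
  obtain ⟨a, ha, rfl⟩ := hp ⊥ (isOpen_discrete _)
  exact congrArg (contraaction P) (ZeroFam.ext' ha)

section Discrete

variable {T : Type u} [Ring T] [UniformSpace T] [DiscreteUniformity T]

/-- The free contramodule on one generator over a discrete ring `T`, as a separated `S`-contramodule
by restriction of scalars along a continuous ring map `S → T`. -/
noncomputable def discreteSepar (φ : S →+* T) (hφ : Continuous φ) : Separ S :=
  (restrictSepar φ hφ).obj ⟨(contraMonad T).free.obj PUnit, isSeparated_of_discreteTopology _⟩

theorem contraaction_discreteSepar (φ : S →+* T) (hφ : Continuous φ) (s : S) :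
    contraaction (discreteSepar φ hφ).obj (s • single (single PUnit.unit : ZeroFam T PUnit)) =
      φ s • (single PUnit.unit : ZeroFam T PUnit) := by
  change joinLinear (mapCoeffLinear φ hφ _ (s • single (single PUnit.unit))) = _
  rw [map_smulₛₗ, mapCoeffLinear_single, map_smul]
  exact congrArg (φ s • ·) (join_single _)

theorem ringHom_ext_of_restrictSepar_full (hfull : (restrictSepar f hf).Full) {φ ψ : S →+* T}
    (hφ : Continuous φ) (hψ : Continuous ψ) (hφψ : φ.comp f = ψ.comp f) : φ = ψ := by
  have hid : IsContraHom (discreteSepar φ hφ).obj (discreteSepar ψ hψ).obj id :=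
    (restrictSepar_full_iff hf).1 hfull _ _ _ fun a =>
      (congrArg ZeroFam.join (ZeroFam.ext' fun x => RingHom.congr_fun hφψ (a x))).trans
        (congrArg (contraaction ((restrictContra f hf).obj (discreteSepar ψ hψ).obj))
          (Contramodules.map_id a).symm)
  have hact (a : ZeroFam S (ZeroFam T PUnit)) :
      contraaction (discreteSepar φ hφ).obj a = contraaction (discreteSepar ψ hψ).obj a :=
    (hid a).trans (congrArg (contraaction (discreteSepar ψ hψ).obj) (Contramodules.map_id a))
  ext s
  have hsmul : φ s • single PUnit.unit = ψ s • (single PUnit.unit : ZeroFam T PUnit) :=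
    (contraaction_discreteSepar φ hφ s).symm.trans
      ((hact _).trans (contraaction_discreteSepar ψ hψ s))
  simpa [ZeroFam.smul_apply, single] using
    congrArg (fun a : ZeroFam T PUnit => a PUnit.unit) hsmul

end Discrete

theorem isProepimorphism_of_restrictSepar_full (hfull : (restrictSepar f hf).Full) :
    IsProepimorphism f := by
  refine isProepimorphism_of_ringHom_ext fun T _ φ ψ hφ hψ hφψ => ?_
  let _ : UniformSpace T := ⊥
  have : DiscreteUniformity T := ⟨rfl⟩
  have continuous_of_isOpen_ker {χ : S →+* T} (hχ : IsOpen (TwoSidedIdeal.ker χ : Set S)) :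
      Continuous χ := by
    refine continuous_of_continuousAt_zero χ ?_
    rw [ContinuousAt, nhds_discrete T, tendsto_pure, map_zero]
    filter_upwards [hχ.mem_nhds (TwoSidedIdeal.zero_mem _)] with s hs
    exact (TwoSidedIdeal.mem_ker χ).1 hs
  exact ringHom_ext_of_restrictSepar_full hf hfull (continuous_of_isOpen_ker hφ)
    (continuous_of_isOpen_ker hψ) hφψ

end FullyFaithful

end Contramodules

theorem mainTheorem8 {R S : Type u}
    [Ring R] [UniformSpace R] [IsUniformAddGroup R] [IsTopologicalRing R]
    [CompleteSpace R] [T2Space R] [IsLinearTopology R R] [IsLinearTopology Rᵐᵒᵖ R]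
    [Ring S] [UniformSpace S] [IsUniformAddGroup S] [IsTopologicalRing S]
    [CompleteSpace S] [T2Space S] [IsLinearTopology S S] [IsLinearTopology Sᵐᵒᵖ S]
    (hR : (𝓝 (0 : R)).IsCountablyGenerated) (hS : (𝓝 (0 : S)).IsCountablyGenerated)
    (f : R →+* S) (hf : Continuous f) (htaut : Contramodules.StronglyRightTaut f) :
    ((Contramodules.restrictSepar f hf).Full ∧ (Contramodules.restrictSepar f hf).Faithful) ↔
      Contramodules.IsProepimorphism f :=
  ⟨fun h => Contramodules.isProepimorphism_of_restrictSepar_full hf h.1,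
    fun h => ⟨h.restrictSepar_full hf htaut hR, Contramodules.restrictSepar_faithful hf⟩⟩
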